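/- Let $\mathfrak S$ be the complex Lie algebra with basis $e,h,f,p,q,z$ and brackets $[h,e]=2e$, $[h,f]=-2f$, $[e,f]=h$, $[h,p]=p$, $[h,q]=-q$, $[p,q]=z$, $[e,q]=p$, $[p,f]=-q$, all other brackets of basis elements being zero (the Schrödinger algebra), let $\mathcal H=\operatorname{span}\{p,q,z\}$ be its Heisenberg subalgebra, let $U(\mathfrak S)$ be the universal enveloping algebra, and put $C_0=p^2f-q^2e-hpq\in U(\mathfrak S)$. Let $\phi:\mathcal H\to\mathbb C$ be a nonzero Lie algebra homomorphism. In an $\mathfrak S$-module, a quasi-Whittaker vector of type $\phi$ is a nonzero vector $v$ with $xv=\phi(x)v$ for all $x\in\mathcal H$; an $\mathfrak S$-module is a quasi-Whittaker module of type $\phi$ if it is generated by a quasi-Whittaker vector of type $\phi$, which is then called a cyclic quasi-Whittaker vector. Theorem. Let $V$ be a quasi-Whittaker module of type $\phi$ with cyclic quasi-Whittaker vector $w$, and suppose that $\operatorname{Ann}_{\mathbb C[C_0]}(w)\neq 0$, with monic generator $d(C_0)=\prod_{i=1}^k(C_0-\xi_i)^{a_i}$, where $\xi_1,\dots,\xi_k\in\mathbb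 C$ are distinct and all $a_i\ge 1$. (i) The maximal submodules of $V$ are exactly the submodules $U(\mathfrak S)(C_0-\xi_i)w$, $i=1,\dots,k$. (ii) For $j=1,\dots,k$ put $d_j(C_0)=\prod_{i\ne j}(C_0-\xi_i)^{a_i}$, $w_j=d_j(C_0)w$ and $V_j=U(\mathfrak S)w_j$. Then each $V_j$ is a quasi-Whittaker module of type $\phi$ with cyclic quasi-Whittaker vector $w_j$, and $V=V_1\oplus\cdots\oplus V_k$. Moreover, each $V_j$ is indecomposable, $V_j$ is simple if and only if $a_j=1$, and the composition length of $V_j$ is $a_j$. In particular, $V$ has a composition series of length $\sum_{i=1}^k a_i$, so that $V$ has composition length $\sum_{i=1}^k a_i$. -/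

import Mathlib

open Polynomial

noncomputable section

namespace Schrodinger

/-- The underlying space of the Schrödinger algebra `𝔖` over `ℂ`: the element with coordinates
`⟨e, h, f, p, q, z⟩` is the linear combination of the six standard basis vectors `e, h, f, p, q, z`
with these coefficients. -/
@[ext]
structure Alg where
  e : ℂ
  h : ℂ
  f : ℂ
  p : ℂ
  q : ℂ
  z : ℂ

namespace Alg

instance : Zero Alg := ⟨⟨0, 0, 0, 0, 0, 0⟩⟩

instance : Add Alg :=
  ⟨fun x y => ⟨x.e + y.e, x.h + y.h, x.f + y.f, x.p + y.p, x.q + y.q, x.z + y.z⟩⟩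

instance : Neg Alg := ⟨fun x => ⟨-x.e, -x.h, -x.f, -x.p, -x.q, -x.z⟩⟩

instance : SMul ℂ Alg := ⟨fun c x => ⟨c * x.e, c * x.h, c * x.f, c * x.p, c * x.q, c * x.z⟩⟩

/-- The Lie bracket, extended bilinearly and antisymmetrically from
`[h,e] = 2e`, `[h,f] = -2f`, `[e,f] = h`, `[h,p] = p`, `[h,q] = -q`, `[p,q] = z`, `[e,q] = p`,
`[p,f] = -q`, all remaining brackets of basis vectors being zero. -/
instance : Bracket Alg Alg :=
  ⟨fun x y =>
    { e := 2 * (x.h * y.e - x.e * y.h)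
      h := x.e * y.f - x.f * y.e
      f := -2 * (x.h * y.f - x.f * y.h)
      p := (x.h * y.p - x.p * y.h) + (x.e * y.q - x.q * y.e)
      q := -(x.h * y.q - x.q * y.h) - (x.p * y.f - x.f * y.p)
      z := x.p * y.q - x.q * y.p }⟩

@[simp] theorem zero_e : (0 : Alg).e = 0 := rfl
@[simp] theorem zero_h : (0 : Alg).h = 0 := rfl
@[simp] theorem zero_f : (0 : Alg).f = 0 := rfl
@[simp] theorem zero_p : (0 : Alg).p = 0 := rfl
@[simp] theorem zero_q : (0 : Alg).q = 0 := rfl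
@[simp] theorem zero_z : (0 : Alg).z = 0 := rfl

@[simp] theorem add_e (x y : Alg) : (x + y).e = x.e + y.e := rfl
@[simp] theorem add_h (x y : Alg) : (x + y).h = x.h + y.h := rfl
@[simp] theorem add_f (x y : Alg) : (x + y).f = x.f + y.f := rfl
@[simp] theorem add_p (x y : Alg) : (x + y).p = x.p + y.p := rfl
@[simp] theorem add_q (x y : Alg) : (x + y).q = x.q + y.q := rfl
@[simp] theorem add_z (x y : Alg) : (x + y).z = x.z + y.z := rfl

@[simp] theorem neg_e (x : Alg) : (-x).e = -x.e := rfl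
@[simp] theorem neg_h (x : Alg) : (-x).h = -x.h := rfl
@[simp] theorem neg_f (x : Alg) : (-x).f = -x.f := rfl
@[simp] theorem neg_p (x : Alg) : (-x).p = -x.p := rfl
@[simp] theorem neg_q (x : Alg) : (-x).q = -x.q := rfl
@[simp] theorem neg_z (x : Alg) : (-x).z = -x.z := rfl

@[simp] theorem smul_e (c : ℂ) (x : Alg) : (c • x).e = c * x.e := rfl
@[simp] theorem smul_h (c : ℂ) (x : Alg) : (c • x).h = c * x.h := rfl
@[simp] theorem smul_f (c : ℂ) (x : Alg) : (c • x).f = c * x.f := rfl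
@[simp] theorem smul_p (c : ℂ) (x : Alg) : (c • x).p = c * x.p := rfl
@[simp] theorem smul_q (c : ℂ) (x : Alg) : (c • x).q = c * x.q := rfl
@[simp] theorem smul_z (c : ℂ) (x : Alg) : (c • x).z = c * x.z := rfl

@[simp] theorem lie_e (x y : Alg) : ⁅x, y⁆.e = 2 * (x.h * y.e - x.e * y.h) := rfl
@[simp] theorem lie_h (x y : Alg) : ⁅x, y⁆.h = x.e * y.f - x.f * y.e := rfl
@[simp] theorem lie_f (x y : Alg) : ⁅x, y⁆.f = -2 * (x.h * y.f - x.f * y.h) := rfl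
@[simp] theorem lie_p (x y : Alg) :
    ⁅x, y⁆.p = (x.h * y.p - x.p * y.h) + (x.e * y.q - x.q * y.e) := rfl
@[simp] theorem lie_q (x y : Alg) :
    ⁅x, y⁆.q = -(x.h * y.q - x.q * y.h) - (x.p * y.f - x.f * y.p) := rfl
@[simp] theorem lie_z (x y : Alg) : ⁅x, y⁆.z = x.p * y.q - x.q * y.p := rfl

instance : AddCommGroup Alg where
  add_assoc x y w := by ext <;> simp [add_assoc]
  zero_add x := by ext <;> simp
  add_zero x := by ext <;> simp
  nsmul := nsmulRec
  zsmul := zsmulRec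
  neg_add_cancel x := by ext <;> simp
  add_comm x y := by ext <;> simp [add_comm]

instance : Module ℂ Alg where
  one_smul x := by ext <;> simp
  mul_smul c d x := by ext <;> simp [mul_assoc]
  smul_zero c := by ext <;> simp
  smul_add c x y := by ext <;> simp [mul_add]
  add_smul c d x := by ext <;> simp [add_mul]
  zero_smul x := by ext <;> simp

instance : LieRing Alg where
  add_lie x y w := by ext <;> simp <;> ring
  lie_add x y w := by ext <;> simp <;> ring
  lie_self x := by ext <;> simp <;> ring
  leibniz_lie x y w := by ext <;> simp <;> ring

instance : LieAlgebra ℂ Alg where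
  lie_smul c x y := by ext <;> simp <;> ring

end Alg

/-- The basis vector `e`. -/
def e : Alg := ⟨1, 0, 0, 0, 0, 0⟩
/-- The basis vector `h`. -/
def h : Alg := ⟨0, 1, 0, 0, 0, 0⟩
/-- The basis vector `f`. -/
def f : Alg := ⟨0, 0, 1, 0, 0, 0⟩
/-- The basis vector `p`. -/
def p : Alg := ⟨0, 0, 0, 1, 0, 0⟩
/-- The basis vector `q`. -/
def q : Alg := ⟨0, 0, 0, 0, 1, 0⟩
/-- The basis vector `z`. -/
def z : Alg := ⟨0, 0, 0, 0, 0, 1⟩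

theorem lie_h_e : ⁅h, e⁆ = (2 : ℂ) • e := by ext <;> simp [h, e]
theorem lie_h_f : ⁅h, f⁆ = (-2 : ℂ) • f := by ext <;> simp [h, f]
theorem lie_e_f : ⁅e, f⁆ = h := by ext <;> simp [h, e, f]
theorem lie_h_p : ⁅h, p⁆ = p := by ext <;> simp [h, p]
theorem lie_h_q : ⁅h, q⁆ = -q := by ext <;> simp [h, q]
theorem lie_p_q : ⁅p, q⁆ = z := by ext <;> simp [p, q, z]
theorem lie_e_q : ⁅e, q⁆ = p := by ext <;> simp [e, p, q]
theorem lie_p_f : ⁅p, f⁆ = -q := by ext <;> simp [p, f, q]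
theorem lie_f_q : ⁅f, q⁆ = 0 := by ext <;> simp [f, q]
theorem lie_e_p : ⁅e, p⁆ = 0 := by ext <;> simp [e, p]
theorem lie_z (x : Alg) : ⁅z, x⁆ = 0 := by ext <;> simp [z]

/-- The Heisenberg subalgebra `ℋ = span {p, q, z}`, described as the vanishing locus of the
coordinates along `e`, `h` and `f`. -/
def heisenberg : LieSubalgebra ℂ Alg where
  carrier := {x | x.e = 0 ∧ x.h = 0 ∧ x.f = 0}
  add_mem' := by
    rintro x y ⟨h1, h2, h3⟩ ⟨k1, k2, k3⟩
    exact ⟨by simp [h1, k1], by simp [h2, k2], by simp [h3, k3]⟩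
  zero_mem' := ⟨rfl, rfl, rfl⟩
  smul_mem' := by
    rintro c x ⟨h1, h2, h3⟩
    exact ⟨by simp [h1], by simp [h2], by simp [h3]⟩
  lie_mem' := by
    rintro x y ⟨h1, h2, h3⟩ ⟨k1, k2, k3⟩
    exact ⟨by simp [h1, h2, k1, k2], by simp [h1, h3, k1, k3], by simp [h2, h3, k2, k3]⟩

theorem heisenberg_eq_span : heisenberg.toSubmodule = Submodule.span ℂ {p, q, z} := by
  apply le_antisymm
  · rintro x ⟨h1, h2, h3⟩
    have hx : x = x.p • p + x.q • q + x.z • z := by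
      ext <;> simp [p, q, z, h1, h2, h3]
    rw [hx]
    refine add_mem (add_mem ?_ ?_) ?_ <;>
      exact Submodule.smul_mem _ _ (Submodule.subset_span (by simp))
  · rw [Submodule.span_le]
    rintro x (rfl | rfl | rfl) <;> exact ⟨rfl, rfl, rfl⟩

/-- The universal enveloping algebra `U(𝔖)`. An `𝔖`-module is the same thing as a left
`U(𝔖)`-module; an element `x` of `𝔖` acts through its image `ι x` in `U(𝔖)`, and a complex number
acts through `algebraMap ℂ U(𝔖)`. -/
abbrev U : Type := UniversalEnvelopingAlgebra ℂ Alg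

/-- The canonical map `𝔖 → U(𝔖)`. -/
def ι (x : Alg) : U := UniversalEnvelopingAlgebra.ι ℂ x

/-- The element `C₀ = p² f - q² e - h p q` of `U(𝔖)`. -/
def C₀ : U := ι p ^ 2 * ι f - ι q ^ 2 * ι e - ι h * ι p * ι q

section Modules

variable {V : Type*} [AddCommGroup V] [Module U V]

/-- A quasi-Whittaker vector of type `φ`, where `φ : ℋ → ℂ` is a homomorphism of Lie algebras:
a nonzero vector `v` such that `x v = φ(x) v` for all `x` in `ℋ`. -/
def IsQuasiWhittakerVector (φ : LieAlgebra.LieCharacter ℂ heisenberg) (v : V) : Prop :=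
  v ≠ 0 ∧ ∀ x : heisenberg, ι (x : Alg) • v = algebraMap ℂ U (φ x) • v

/-- A cyclic quasi-Whittaker vector of type `φ`: it generates the whole module. -/
def IsCyclicQuasiWhittakerVector (φ : LieAlgebra.LieCharacter ℂ heisenberg) (v : V) : Prop :=
  IsQuasiWhittakerVector φ v ∧ Submodule.span U {v} = ⊤

/-- The annihilator of `w` in `ℂ[C₀]`. Polynomials `g ∈ ℂ[X]` stand for the elements `g(C₀)`, and
the annihilator is the ideal of those `g` with `g(C₀) w = 0`. -/
def annC₀ (w : V) : Ideal ℂ[X] :=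
  (Ideal.torsionOf U V w).comap (aeval C₀ : ℂ[X] →ₐ[ℂ] U)

theorem mem_annC₀ (w : V) (g : ℂ[X]) : g ∈ annC₀ w ↔ aeval C₀ g • w = 0 := by
  simp [annC₀, Ideal.mem_comap, Ideal.mem_torsionOf_iff]

end Modules

variable (V : Type*) [AddCommGroup V] [Module U V] in
/-- `V` is a quasi-Whittaker module of type `φ`. -/
def IsQuasiWhittakerModule (φ : LieAlgebra.LieCharacter ℂ heisenberg) : Prop :=
  ∃ v : V, IsCyclicQuasiWhittakerVector φ v

/-- A module is indecomposable if it is nonzero and is not the direct sum of two nonzero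
submodules. -/
def IsIndecomposable (R M : Type*) [Ring R] [AddCommGroup M] [Module R M] : Prop :=
  Nontrivial M ∧ ∀ A B : Submodule R M, IsCompl A B → A = ⊥ ∨ B = ⊥

end Schrodinger

end

/-!
A quasi-Whittaker module of type `φ` is generated by a vector on which `ℋ` acts by `φ`, and
`φ z = φ [p, q] = 0`; as `z` is central in `U(𝔖)`, it acts by zero on the whole module. Modulo `z` the
element `C₀` is central, so polynomials in `C₀` act by module endomorphisms (`aeval_C₀_smul_comm`).

The core is that a quasi-Whittaker module on which `C₀` acts by a scalar `ξ` is simple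
(`IsCyclicQuasiWhittakerVector.isSimpleModule`). Write `α = φ p` and `β = φ q`; they are not both zero,
and the symmetry `e ↔ f`, `h ↦ -h`, `p ↔ q` allows one to assume `α ≠ 0`. The relation `C₀ w = ξ w` then
expresses `f w` through `w`, `e w`, `h w`, so the module is the union of the subspaces `F n` spanned by
the words of length at most `n` in `e` and `h` applied to `w`. The operators `p - α` and `q - β` map
`F (n + 1)` to `F n`, and the Euler operator `(h + (β / α) e) (p - α) + e (q - β)` acts on
`F (n + 1)` as `-α (n + 1)` modulo `F n` (`SchrodingerRep.euler_add_mem`). In a nonzero submodule pick a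
nonzero element of least degree. It is killed by `p - α` and `q - β`, hence by the Euler operator, so
its degree is zero and the submodule contains `w`. This avoids any use of the
Poincaré–Birkhoff–Witt theorem or of the universal quasi-Whittaker module.

The rest is formal. The submodule generated by `(C₀ - ξ) w` is the whole module or maximal, because
the quotient by it is a quasi-Whittaker module on which `C₀` acts by `ξ`. The annihilator of `w` in
`ℂ[C₀]` modulo a maximal submodule is prime, so it contains one of the factors `C₀ - ξ i`; this gives
the maximal submodules. The Chinese remainder theorem gives the decomposition
(`isInternal_span_prod_erase`). Each summand has a generator with annihilator `(X - ξ j) ^ a j`: it has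
only one maximal submodule, so it is indecomposable, and the submodules generated by the
`(C₀ - ξ j) ^ m w j` form a composition series of length `a j` (`length_eq_of_pow_mem`).
-/

namespace Schrodinger

/-! ### Representations with trivial central charge -/

/-- Five operators on a complex vector space satisfying the relations of the Schrödinger algebra
with `z` acting by zero. Quasi-Whittaker modules are of this kind, and the relations have the
symmetry `SchrodingerRep.swap`. -/
structure SchrodingerRep (V : Type*) [AddCommGroup V] [Module ℂ V] where
  e : V →ₗ[ℂ] V
  h : V →ₗ[ℂ] V
  f : V →ₗ[ℂ] V
  p : V →ₗ[ℂ] V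
  q : V →ₗ[ℂ] V
  h_e : ∀ x, h (e x) = e (h x) + (2 : ℂ) • e x
  h_f : ∀ x, h (f x) = f (h x) - (2 : ℂ) • f x
  e_f : ∀ x, e (f x) = f (e x) + h x
  h_p : ∀ x, h (p x) = p (h x) + p x
  h_q : ∀ x, h (q x) = q (h x) - q x
  q_p : ∀ x, q (p x) = p (q x)
  e_q : ∀ x, e (q x) = q (e x) + p x
  f_p : ∀ x, f (p x) = p (f x) + q x
  f_q : ∀ x, f (q x) = q (f x)
  e_p : ∀ x, e (p x) = p (e x)

namespace SchrodingerRep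

variable {V : Type*} [AddCommGroup V] [Module ℂ V] (A : SchrodingerRep V)

/-- The operator of `C₀ = p² f - q² e - h p q`. -/
def casimir : V →ₗ[ℂ] V := A.p * A.p * A.f - A.q * A.q * A.e - A.h * A.p * A.q

theorem casimir_apply (x : V) :
    A.casimir x = A.p (A.p (A.f x)) - A.q (A.q (A.e x)) - A.h (A.p (A.q x)) := rfl

/-- `C₀` is central modulo `z`. -/
theorem casimir_comm (x : V) :
    A.casimir (A.e x) = A.e (A.casimir x) ∧ A.casimir (A.h x) = A.h (A.casimir x) ∧
    A.casimir (A.f x) = A.f (A.casimir x) ∧ A.casimir (A.p x) = A.p (A.casimir x) ∧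
    A.casimir (A.q x) = A.q (A.casimir x) := by
  refine ⟨?_, ?_, ?_, ?_, ?_⟩ <;>
  · simp only [casimir_apply, map_add, map_sub, map_smul, A.h_e, A.h_f, A.e_f, A.h_p, A.h_q, A.q_p,
      A.e_q, A.f_p, A.f_q, A.e_p]
    module

/-- The symmetry `e ↔ f`, `h ↦ -h`, `p ↔ q`, which changes the sign of `C₀`. -/
def swap : SchrodingerRep V where
  e := A.f
  h := -A.h
  f := A.e
  p := A.q
  q := A.p
  h_e x := by simp only [LinearMap.neg_apply, A.h_f, map_neg]; module
  h_f x := by simp only [LinearMap.neg_apply, A.h_e, map_neg]; module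
  e_f x := by simp only [LinearMap.neg_apply, A.e_f]; module
  h_p x := by simp only [LinearMap.neg_apply, A.h_q, map_neg]; module
  h_q x := by simp only [LinearMap.neg_apply, A.h_p, map_neg]; module
  q_p x := (A.q_p x).symm
  e_q x := A.f_p x
  f_p x := A.e_q x
  f_q x := A.e_p x
  e_p x := A.f_q x

theorem casimir_swap (x : V) : A.swap.casimir x = -A.casimir x := by
  simp only [casimir_apply, swap, LinearMap.neg_apply, A.q_p]
  module

/-- Stability of a subspace under all five operators. -/
structure IsStable (N : Submodule ℂ V) : Prop where
  e : ∀ x ∈ N, A.e x ∈ N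
  h : ∀ x ∈ N, A.h x ∈ N
  f : ∀ x ∈ N, A.f x ∈ N
  p : ∀ x ∈ N, A.p x ∈ N
  q : ∀ x ∈ N, A.q x ∈ N

variable {A} in
theorem isStable_swap_iff {N : Submodule ℂ V} : A.swap.IsStable N ↔ A.IsStable N :=
  ⟨fun hN => ⟨hN.f, fun x hx => N.neg_mem_iff.1 (hN.h x hx), hN.e, hN.q, hN.p⟩,
    fun hN => ⟨hN.f, fun x hx => N.neg_mem (hN.h x hx), hN.e, hN.q, hN.p⟩⟩

/-- The span of the vectors obtained from `v` by at most `n` applications of `e` and `h`. -/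
def filtration (v : V) : ℕ → Submodule ℂ V
  | 0 => Submodule.span ℂ {v}
  | n + 1 => filtration v n ⊔ ((filtration v n).map A.e ⊔ (filtration v n).map A.h)

variable {A} {v : V} {α β : ℂ}

theorem filtration_mono : Monotone (A.filtration v) :=
  monotone_nat_of_le_succ fun _ => le_sup_left

theorem e_mem_filtration {n : ℕ} {x : V} (hx : x ∈ A.filtration v n) :
    A.e x ∈ A.filtration v (n + 1) :=
  (le_sup_left.trans le_sup_right : _ ≤ A.filtration v (n + 1)) (Submodule.mem_map_of_mem hx)

theorem h_mem_filtration {n : ℕ} {x : V} (hx : x ∈ A.filtration v n) :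
    A.h x ∈ A.filtration v (n + 1) :=
  (le_sup_right.trans le_sup_right : _ ≤ A.filtration v (n + 1)) (Submodule.mem_map_of_mem hx)

/-- To bound a linear map on one step of the filtration it suffices to treat the previous step and
its images under `e` and `h`. -/
theorem filtration_succ_le_comap {n : ℕ} {N : Submodule ℂ V} {T : V →ₗ[ℂ] V}
    (h0 : ∀ x ∈ A.filtration v n, T x ∈ N) (he : ∀ x ∈ A.filtration v n, T (A.e x) ∈ N)
    (hh : ∀ x ∈ A.filtration v n, T (A.h x) ∈ N) :
    ∀ x ∈ A.filtration v (n + 1), T x ∈ N := by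
  change A.filtration v (n + 1) ≤ N.comap T
  refine sup_le h0 (sup_le ?_ ?_)
  · rintro _ ⟨y, hy, rfl⟩; exact he y hy
  · rintro _ ⟨y, hy, rfl⟩; exact hh y hy

theorem sub_zero_filtration (hp : A.p v = α • v) (hq : A.q v = β • v) :
    ∀ x ∈ A.filtration v 0, A.p x - α • x = 0 ∧ A.q x - β • x = 0 := by
  intro x hx
  obtain ⟨c, rfl⟩ := Submodule.mem_span_singleton.1 hx
  rw [map_smul, map_smul, hp, hq]
  constructor <;> module

/-- `p - α` and `q - β` lower the filtration degree. -/
theorem sub_mem_filtration (hp : A.p v = α • v) (hq : A.q v = β • v) (n : ℕ) :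
    ∀ x ∈ A.filtration v (n + 1),
      A.p x - α • x ∈ A.filtration v n ∧ A.q x - β • x ∈ A.filtration v n := by
  suffices H : (∀ x ∈ A.filtration v (n + 1), (A.p - α • (LinearMap.id : V →ₗ[ℂ] V)) x ∈ A.filtration v n) ∧
      ∀ x ∈ A.filtration v (n + 1), (A.q - β • (LinearMap.id : V →ₗ[ℂ] V)) x ∈ A.filtration v n from
    fun x hx => ⟨H.1 x hx, H.2 x hx⟩
  -- The passage from degree `n` to degree `n + 1`, uniformly in `n`. In degree zero the hypotheses
  -- hold because `p - α` and `q - β` vanish there; there is no filtration step below it to appeal to.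
  have key : ∀ n, ((∀ x ∈ A.filtration v n, A.p x - α • x ∈ A.filtration v n ∧
      A.e (A.p x - α • x) ∈ A.filtration v n ∧ A.h (A.p x - α • x) ∈ A.filtration v n) ∧
      (∀ x ∈ A.filtration v n, A.q x - β • x ∈ A.filtration v n ∧
      A.e (A.q x - β • x) ∈ A.filtration v n ∧ A.h (A.q x - β • x) ∈ A.filtration v n)) →
      (∀ x ∈ A.filtration v (n + 1), (A.p - α • (LinearMap.id : V →ₗ[ℂ] V)) x ∈ A.filtration v n) ∧
      ∀ x ∈ A.filtration v (n + 1), (A.q - β • (LinearMap.id : V →ₗ[ℂ] V)) x ∈ A.filtration v n := by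
    rintro n ⟨h1, h2⟩
    constructor
    · refine filtration_succ_le_comap (fun x hx => (h1 x hx).1) (fun x hx => ?_) fun x hx => ?_
      · convert (h1 x hx).2.1 using 1
        simp [A.e_p]
      · convert sub_mem (h1 x hx).2.2 (add_mem (h1 x hx).1 (Submodule.smul_mem _ α hx)) using 1
        simp [A.h_p]; abel
    · refine filtration_succ_le_comap (fun x hx => (h2 x hx).1) (fun x hx => ?_) fun x hx => ?_
      · convert sub_mem (h2 x hx).2.1 (add_mem (h1 x hx).1 (Submodule.smul_mem _ α hx)) using 1
        simp [A.e_q]; abel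
      · convert add_mem (h2 x hx).2.2 (add_mem (h2 x hx).1 (Submodule.smul_mem _ β hx)) using 1
        simp [A.h_q]; abel
  induction n with
  | zero =>
    apply key
    constructor
    · intro x hx; simp [(sub_zero_filtration hp hq x hx).1]
    · intro x hx; simp [(sub_zero_filtration hp hq x hx).2]
  | succ n ih =>
    apply key
    constructor
    · intro x hx
      exact ⟨filtration_mono n.le_succ (ih.1 x hx), e_mem_filtration (ih.1 x hx),
        h_mem_filtration (ih.1 x hx)⟩
    · intro x hx
      exact ⟨filtration_mono n.le_succ (ih.2 x hx), e_mem_filtration (ih.2 x hx),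
        h_mem_filtration (ih.2 x hx)⟩

/-- The Euler operator `h (p - α) + (β / α) e (p - α) + e (q - β)`. In the model where `p`, `q` are
coordinates on the plane, `e = p ∂_q` and `h = p ∂_p - q ∂_q`, its leading part at the point `(α, β)`
is `α ((p - α) ∂_p + (q - β) ∂_q)`, up to the order of the factors. -/
noncomputable def euler (A : SchrodingerRep V) (α β : ℂ) : V →ₗ[ℂ] V :=
  (A.h + (β / α) • A.e) * (A.p - α • (LinearMap.id : V →ₗ[ℂ] V)) +
    A.e * (A.q - β • (LinearMap.id : V →ₗ[ℂ] V))

theorem euler_apply (x : V) : A.euler α β x =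
    A.h (A.p x - α • x) + (β / α) • A.e (A.p x - α • x) + A.e (A.q x - β • x) := rfl

theorem euler_e (x : V) :
    A.euler α β (A.e x) = A.e (A.euler α β x) + A.e (A.p x - α • x) - α • A.e x := by
  simp only [euler_apply, map_add, map_sub, map_smul, A.h_e, A.h_p, A.e_q, A.e_p]
  module

theorem euler_h (hα : α ≠ 0) (x : V) :
    A.euler α β (A.h x) = A.h (A.euler α β x) - A.h (A.p x - α • x)
      - (3 * (β / α)) • A.e (A.p x - α • x) - A.e (A.q x - β • x) - α • A.h x := by
  simp only [euler_apply, map_add, map_sub, map_smul, A.h_e, A.h_p, A.h_q, A.e_q, A.e_p]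
  match_scalars <;> field_simp <;> ring

/-- The Euler operator counts the filtration degree, up to lower order terms. -/
theorem euler_add_mem (hα : α ≠ 0) (hp : A.p v = α • v) (hq : A.q v = β • v) (n : ℕ) :
    ∀ x ∈ A.filtration v (n + 1), A.euler α β x + (α * (n + 1)) • x ∈ A.filtration v n := by
  -- As in `sub_mem_filtration`, one step for all `n`, with degree zero checked directly.
  have key : ∀ n : ℕ, (∀ x ∈ A.filtration v n,
      A.e (A.euler α β x + (α * n) • x) ∈ A.filtration v n ∧
      A.h (A.euler α β x + (α * n) • x) ∈ A.filtration v n ∧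
      A.e (A.p x - α • x) ∈ A.filtration v n ∧ A.h (A.p x - α • x) ∈ A.filtration v n ∧
      A.e (A.q x - β • x) ∈ A.filtration v n) →
      ∀ x ∈ A.filtration v (n + 1),
        (A.euler α β + (α * (n + 1)) • (LinearMap.id : V →ₗ[ℂ] V)) x ∈ A.filtration v n := by
    intro n H
    refine filtration_succ_le_comap (fun x hx => ?_) (fun x hx => ?_) fun x hx => ?_
    all_goals
      obtain ⟨h1, h2, h3, h4, h5⟩ := H x hx
      simp only [LinearMap.add_apply, LinearMap.smul_apply, LinearMap.id_apply]
    · rw [euler_apply]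
      exact add_mem (add_mem (add_mem h4 (Submodule.smul_mem _ _ h3)) h5)
        (Submodule.smul_mem _ _ hx)
    · convert add_mem h1 h3 using 1
      rw [euler_e, map_add, map_smul]
      module
    · convert sub_mem (sub_mem (sub_mem h2 h4) (Submodule.smul_mem _ (3 * (β / α)) h3)) h5 using 1
      rw [euler_h hα, map_add, map_smul]
      module
  induction n with
  | zero =>
    apply key
    intro x hx
    obtain ⟨h1, h2⟩ := sub_zero_filtration hp hq x hx
    simp [euler_apply, h1, h2]
  | succ n ih =>
    apply key
    intro x hx
    obtain ⟨h1, h2⟩ := sub_mem_filtration hp hq n x hx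
    have h3 := ih x hx
    push_cast
    exact ⟨e_mem_filtration h3, h_mem_filtration h3, e_mem_filtration h1, h_mem_filtration h1,
      e_mem_filtration h2⟩

/-- A vector of positive degree on which `p` and `q` act by the scalars `α` and `β` has smaller
degree, since the Euler operator kills it. -/
theorem mem_filtration_of_eigen (hα : α ≠ 0) (hp : A.p v = α • v) (hq : A.q v = β • v) {n : ℕ}
    {x : V} (hx : x ∈ A.filtration v (n + 1)) (hpx : A.p x - α • x = 0)
    (hqx : A.q x - β • x = 0) : x ∈ A.filtration v n := by
  have h1 := euler_add_mem hα hp hq n x hx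
  rw [euler_apply, hpx, hqx, map_zero, map_zero, smul_zero, add_zero, zero_add, zero_add] at h1
  exact (Submodule.smul_mem_iff _ (mul_ne_zero hα (Nat.cast_add_one_ne_zero n))).1 h1

/-- A nonzero subspace of the union of the filtration that is stable under `p` and `q` contains
`v`: a nonzero element of least degree is an eigenvector, so its degree is zero. -/
theorem mem_of_filtration (hα : α ≠ 0) (hp : A.p v = α • v) (hq : A.q v = β • v)
    {N : Submodule ℂ V} (hNp : ∀ x ∈ N, A.p x ∈ N) (hNq : ∀ x ∈ N, A.q x ∈ N) (n : ℕ) :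
    ∀ x ∈ A.filtration v n, x ∈ N → x ≠ 0 → v ∈ N := by
  induction n with
  | zero =>
    intro x hx hxN hx0
    obtain ⟨c, rfl⟩ := Submodule.mem_span_singleton.1 hx
    exact (Submodule.smul_mem_iff _ (left_ne_zero_of_smul hx0)).1 hxN
  | succ n ih =>
    intro x hx hxN hx0
    obtain ⟨h1, h2⟩ := sub_mem_filtration hp hq n x hx
    by_cases h3 : A.p x - α • x = 0
    · by_cases h4 : A.q x - β • x = 0
      · exact ih x (mem_filtration_of_eigen hα hp hq hx h3 h4) hxN hx0
      · exact ih _ h2 (sub_mem (hNq x hxN) (N.smul_mem _ hxN)) h4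
    · exact ih _ h1 (sub_mem (hNp x hxN) (N.smul_mem _ hxN)) h3

/-- If `C₀` acts on `v` by a scalar, then the filtration is exhausted by a stable subspace. Since
`α ≠ 0`, the scalar action of `C₀` expresses `f v` through `v`, `e v` and `h v`. -/
theorem isStable_iSup_filtration (hα : α ≠ 0) (hp : A.p v = α • v) (hq : A.q v = β • v) {ξ : ℂ}
    (hξ : A.casimir v = ξ • v) : A.IsStable (⨆ n, A.filtration v n) := by
  have hmem : ∀ {x}, x ∈ ⨆ n, A.filtration v n ↔ ∃ n, x ∈ A.filtration v n :=
    Submodule.mem_iSup_of_directed _ filtration_mono.directed_le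
  have hv : v ∈ A.filtration v 0 := Submodule.mem_span_singleton_self v
  have hfv : A.f v ∈ A.filtration v 1 := by
    have h1 : (α ^ 2) • A.f v = ξ • v + (β ^ 2) • A.e v + (α * β) • A.h v := by
      have h2 (x : V) : A.p (A.f x) = A.f (A.p x) - A.q x := by rw [A.f_p]; abel
      have h3 (x : V) : A.q (A.e x) = A.e (A.q x) - A.p x := by rw [A.e_q]; abel
      rw [← hξ]
      simp only [casimir_apply, h2, h3, map_sub, map_smul, hp, hq]
      module
    rw [← Submodule.smul_mem_iff _ (pow_ne_zero 2 hα), h1]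
    have hv1 := filtration_mono (A := A) zero_le_one hv
    exact add_mem (add_mem (Submodule.smul_mem _ _ hv1)
      (Submodule.smul_mem _ _ (e_mem_filtration hv)))
      (Submodule.smul_mem _ _ (h_mem_filtration hv))
  have hf : ∀ n, ∀ x ∈ A.filtration v n, A.f x ∈ A.filtration v (n + 1) := by
    intro n
    induction n with
    | zero =>
      intro x hx
      obtain ⟨c, rfl⟩ := Submodule.mem_span_singleton.1 hx
      rw [map_smul]
      exact Submodule.smul_mem _ _ hfv
    | succ n ih =>
      refine filtration_succ_le_comap (fun x hx => filtration_mono (n + 1).le_succ (ih x hx))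
        (fun x hx => ?_) fun x hx => ?_
      · rw [← add_sub_cancel_right (A.f (A.e x)) (A.h x), ← A.e_f]
        exact sub_mem (e_mem_filtration (ih x hx))
          (filtration_mono (n + 1).le_succ (h_mem_filtration hx))
      · rw [← sub_add_cancel (A.f (A.h x)) ((2 : ℂ) • A.f x), ← A.h_f]
        exact add_mem (h_mem_filtration (ih x hx))
          (Submodule.smul_mem _ _ (filtration_mono (n + 1).le_succ (ih x hx)))
  have hpq : ∀ n, ∀ x ∈ A.filtration v n, A.p x ∈ A.filtration v n ∧ A.q x ∈ A.filtration v n := by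
    intro n x hx
    obtain ⟨h1, h2⟩ := sub_mem_filtration hp hq n x (filtration_mono n.le_succ hx)
    exact ⟨by simpa using add_mem h1 (Submodule.smul_mem _ α hx),
      by simpa using add_mem h2 (Submodule.smul_mem _ β hx)⟩
  constructor <;> intro x hx <;> obtain ⟨n, hn⟩ := hmem.1 hx
  · exact hmem.2 ⟨_, e_mem_filtration hn⟩
  · exact hmem.2 ⟨_, h_mem_filtration hn⟩
  · exact hmem.2 ⟨_, hf n x hn⟩
  · exact hmem.2 ⟨_, (hpq n x hn).1⟩
  · exact hmem.2 ⟨_, (hpq n x hn).2⟩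

/-- The case `α ≠ 0` of `mem_of_isStable`. -/
theorem mem_of_isStable_aux (hα : α ≠ 0) (hp : A.p v = α • v) (hq : A.q v = β • v) {ξ : ℂ}
    (hξ : A.casimir v = ξ • v) {N : Submodule ℂ V} (hN : A.IsStable N) {x : V} (hxN : x ∈ N)
    (hx0 : x ≠ 0) (hx : ∀ M : Submodule ℂ V, A.IsStable M → v ∈ M → x ∈ M) : v ∈ N := by
  obtain ⟨n, hn⟩ := (Submodule.mem_iSup_of_directed _ filtration_mono.directed_le).1
    (hx _ (isStable_iSup_filtration hα hp hq hξ)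
      (Submodule.mem_iSup_of_mem 0 (Submodule.mem_span_singleton_self v)))
  exact mem_of_filtration hα hp hq hN.p hN.q n x hn hxN hx0

/-- If `C₀` acts on a quasi-Whittaker vector `v` of nonzero type by a scalar, then every nonzero
stable subspace of the stable subspace generated by `v` contains `v`. -/
theorem mem_of_isStable (hαβ : α ≠ 0 ∨ β ≠ 0) (hp : A.p v = α • v) (hq : A.q v = β • v) {ξ : ℂ}
    (hξ : A.casimir v = ξ • v) {N : Submodule ℂ V} (hN : A.IsStable N) {x : V} (hxN : x ∈ N)
    (hx0 : x ≠ 0) (hx : ∀ M : Submodule ℂ V, A.IsStable M → v ∈ M → x ∈ M) : v ∈ N := by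
  rcases hαβ with hα | hβ
  · exact mem_of_isStable_aux hα hp hq hξ hN hxN hx0 hx
  · refine mem_of_isStable_aux (A := A.swap) (ξ := -ξ) hβ hq hp ?_ (isStable_swap_iff.2 hN) hxN hx0
      fun M hM => hx M (isStable_swap_iff.1 hM)
    rw [casimir_swap, hξ, neg_smul]

end SchrodingerRep
/-! ### Modules over the enveloping algebra -/

theorem U_induction {P : U → Prop} (halg : ∀ c, P (algebraMap ℂ U c)) (hι : ∀ x, P (ι x))
    (hmul : ∀ u v, P u → P v → P (u * v)) (hadd : ∀ u v, P u → P v → P (u + v)) (u : U) : P u := by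
  obtain ⟨t, rfl⟩ : ∃ t, UniversalEnvelopingAlgebra.mkAlgHom ℂ Alg t = u :=
    RingCon.mkₐ_surjective _ u
  induction t using TensorAlgebra.induction with
  | algebraMap c => rw [AlgHom.commutes]; exact halg c
  | ι x => exact hι x
  | mul a b ha hb => rw [map_mul]; exact hmul _ _ ha hb
  | add a b ha hb => rw [map_add]; exact hadd _ _ ha hb

theorem ι_add (x y : Alg) : ι (x + y) = ι x + ι y :=
  map_add (UniversalEnvelopingAlgebra.ι ℂ) x y

theorem ι_smul (c : ℂ) (x : Alg) : ι (c • x) = c • ι x :=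
  map_smul (UniversalEnvelopingAlgebra.ι ℂ) c x

theorem ι_neg (x : Alg) : ι (-x) = -ι x :=
  map_neg (UniversalEnvelopingAlgebra.ι ℂ) x

theorem ι_zero : ι 0 = 0 := map_zero (UniversalEnvelopingAlgebra.ι ℂ)

attribute [local instance] LieRing.ofAssociativeRing in
theorem ι_mul_ι (x y : Alg) : ι x * ι y = ι y * ι x + ι ⁅x, y⁆ := by
  have h1 : ι ⁅x, y⁆ = ι x * ι y - ι y * ι x := LieHom.map_lie (UniversalEnvelopingAlgebra.ι ℂ) x y
  rw [h1]; abel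

theorem ι_eq (x : Alg) : ι x = x.e • ι e + x.h • ι h + x.f • ι f + x.p • ι p + x.q • ι q +
    x.z • ι z := by
  simp only [← ι_smul, ← ι_add]
  congr 1
  ext <;> simp [e, h, f, p, q, z]

theorem ι_z_mul (u : U) : ι z * u = u * ι z := by
  induction u using U_induction with
  | halg c => exact (Algebra.commutes c _).symm
  | hι x => rw [ι_mul_ι, lie_z, ι_zero, add_zero]
  | hmul a b ha hb => rw [← mul_assoc, ha, mul_assoc, hb, mul_assoc]
  | hadd a b ha hb => rw [mul_add, add_mul, ha, hb]

variable {V : Type*} [AddCommGroup V] [Module U V]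

section Rep

variable [Module ℂ V] [IsScalarTower ℂ U V]

/-- The operators of a `U(𝔖)`-module on which `z` acts by zero. -/
noncomputable def moduleRep (hz : ∀ x : V, ι z • x = 0) : SchrodingerRep V where
  e := Algebra.lsmul ℂ ℂ V (ι e)
  h := Algebra.lsmul ℂ ℂ V (ι h)
  f := Algebra.lsmul ℂ ℂ V (ι f)
  p := Algebra.lsmul ℂ ℂ V (ι p)
  q := Algebra.lsmul ℂ ℂ V (ι q)
  h_e x := by
    simp only [Algebra.lsmul_coe, ← mul_smul]
    rw [ι_mul_ι, lie_h_e, ι_smul, add_smul, smul_assoc]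
  h_f x := by
    simp only [Algebra.lsmul_coe, ← mul_smul]
    rw [ι_mul_ι, lie_h_f, ι_smul, add_smul, smul_assoc, neg_smul, sub_eq_add_neg]
  e_f x := by
    simp only [Algebra.lsmul_coe, ← mul_smul]
    rw [ι_mul_ι, lie_e_f, add_smul]
  h_p x := by
    simp only [Algebra.lsmul_coe, ← mul_smul]
    rw [ι_mul_ι, lie_h_p, add_smul]
  h_q x := by
    simp only [Algebra.lsmul_coe, ← mul_smul]
    rw [ι_mul_ι, lie_h_q, ι_neg, add_smul, neg_smul, sub_eq_add_neg]
  q_p x := by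
    simp only [Algebra.lsmul_coe, ← mul_smul]
    rw [ι_mul_ι p q, lie_p_q, add_smul, hz, add_zero]
  e_q x := by
    simp only [Algebra.lsmul_coe, ← mul_smul]
    rw [ι_mul_ι, lie_e_q, add_smul]
  f_p x := by
    simp only [Algebra.lsmul_coe, ← mul_smul]
    rw [ι_mul_ι p f, lie_p_f, ι_neg, add_smul, neg_smul, neg_add_cancel_right]
  f_q x := by
    simp only [Algebra.lsmul_coe, ← mul_smul]
    rw [ι_mul_ι, lie_f_q, ι_zero, add_zero]
  e_p x := by
    simp only [Algebra.lsmul_coe, ← mul_smul]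
    rw [ι_mul_ι, lie_e_p, ι_zero, add_zero]

theorem moduleRep_casimir (hz : ∀ x : V, ι z • x = 0) (x : V) :
    (moduleRep hz).casimir x = C₀ • x := by
  simp only [SchrodingerRep.casimir_apply, moduleRep, Algebra.lsmul_coe, C₀, sub_smul, mul_smul,
    pow_two]

theorem ι_smul_eq (hz : ∀ x : V, ι z • x = 0) (y : Alg) (x : V) :
    ι y • x = y.e • (moduleRep hz).e x + y.h • (moduleRep hz).h x + y.f • (moduleRep hz).f x +
      y.p • (moduleRep hz).p x + y.q • (moduleRep hz).q x := by
  rw [ι_eq y]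
  simp only [add_smul, smul_assoc, hz, smul_zero, add_zero]
  rfl

theorem smul_mem_of_isStable (hz : ∀ x : V, ι z • x = 0) {M : Submodule ℂ V}
    (hM : (moduleRep hz).IsStable M) (u : U) : ∀ x ∈ M, u • x ∈ M := by
  induction u using U_induction with
  | halg c => intro x hx; rw [algebraMap_smul]; exact M.smul_mem c hx
  | hι y =>
    intro x hx
    rw [ι_smul_eq hz]
    exact add_mem (add_mem (add_mem (add_mem (M.smul_mem _ (hM.e x hx)) (M.smul_mem _ (hM.h x hx)))
      (M.smul_mem _ (hM.f x hx))) (M.smul_mem _ (hM.p x hx))) (M.smul_mem _ (hM.q x hx))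
  | hmul a b ha hb => intro x hx; rw [mul_smul]; exact ha _ (hb x hx)
  | hadd a b ha hb => intro x hx; rw [add_smul]; exact add_mem (ha x hx) (hb x hx)

end Rep

/-- The complex vector space underlying a `U(𝔖)`-module. -/
abbrev complexModule (V : Type*) [AddCommGroup V] [Module U V] : Module ℂ V :=
  Module.compHom V (algebraMap ℂ U)

theorem complexModule_isScalarTower (V : Type*) [AddCommGroup V] [Module U V] :
    letI := complexModule V
    IsScalarTower ℂ U V :=
  letI := complexModule V
  ⟨fun c u x => by rw [Algebra.smul_def, mul_smul]; rfl⟩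

/-- On a module where `z` acts by zero, `C₀` acts by a module endomorphism. -/
theorem C₀_smul_comm (hz : ∀ x : V, ι z • x = 0) (u : U) (x : V) :
    C₀ • u • x = u • C₀ • x := by
  let := complexModule V
  have := complexModule_isScalarTower V
  revert x
  induction u using U_induction with
  | halg c => intro x; rw [← mul_smul, ← mul_smul, Algebra.commutes]
  | hι y =>
    intro x
    obtain ⟨h1, h2, h3, h4, h5⟩ := (moduleRep hz).casimir_comm x
    rw [ι_smul_eq hz, ι_smul_eq hz, ← moduleRep_casimir hz, ← moduleRep_casimir hz]
    simp only [map_add, map_smul, h1, h2, h3, h4, h5]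
  | hmul a b ha hb => intro x; rw [mul_smul, ha, hb, mul_smul]
  | hadd a b ha hb => intro x; rw [add_smul, smul_add, ha, hb, add_smul]

theorem aeval_C₀_smul_comm (hz : ∀ x : V, ι z • x = 0) (g : ℂ[X]) (u : U) (x : V) :
    aeval C₀ g • u • x = u • aeval C₀ g • x := by
  induction g using Polynomial.induction_on' generalizing x with
  | add a b ha hb => rw [map_add, add_smul, add_smul, smul_add, ha, hb]
  | monomial n c =>
    rw [aeval_monomial, mul_smul, mul_smul, ← mul_smul u, ← Algebra.commutes, mul_smul]
    congr 1
    induction n generalizing x with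
    | zero => simp
    | succ n ih => rw [pow_succ, mul_smul, mul_smul, C₀_smul_comm hz, ih]

/-! ### Quasi-Whittaker vectors -/

variable {φ : LieAlgebra.LieCharacter ℂ heisenberg}

/-- The element `p` of the Heisenberg subalgebra. -/
def heisenbergP : heisenberg := ⟨p, rfl, rfl, rfl⟩

/-- The element `q` of the Heisenberg subalgebra. -/
def heisenbergQ : heisenberg := ⟨q, rfl, rfl, rfl⟩

/-- The element `z` of the Heisenberg subalgebra. -/
def heisenbergZ : heisenberg := ⟨z, rfl, rfl, rfl⟩

attribute [local instance] LieRing.ofAssociativeRing in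
theorem character_z (φ : LieAlgebra.LieCharacter ℂ heisenberg) : φ heisenbergZ = 0 := by
  have h1 : heisenbergZ = ⁅heisenbergP, heisenbergQ⁆ := Subtype.ext lie_p_q.symm
  rw [h1, LieAlgebra.lieCharacter_apply_lie]

attribute [local instance] LieRing.ofAssociativeRing in
theorem character_ne_zero (hφ : φ ≠ 0) : φ heisenbergP ≠ 0 ∨ φ heisenbergQ ≠ 0 := by
  by_contra! hc
  refine hφ (LieHom.ext fun x => ?_)
  have hx : x = x.1.p • heisenbergP + x.1.q • heisenbergQ + x.1.z • heisenbergZ := by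
    obtain ⟨x, h1, h2, h3⟩ := x
    apply Subtype.ext
    ext <;> simp [heisenbergP, heisenbergQ, heisenbergZ, p, q, z, h1, h2, h3]
  rw [hx]
  simp only [map_add, map_smul, hc.1, hc.2, character_z]
  simp

theorem IsCyclicQuasiWhittakerVector.exists_smul {w : V} (hw : IsCyclicQuasiWhittakerVector φ w)
    (x : V) : ∃ u : U, u • w = x :=
  Submodule.mem_span_singleton.1 (hw.2 ▸ Submodule.mem_top)

theorem IsCyclicQuasiWhittakerVector.z_smul {w : V} (hw : IsCyclicQuasiWhittakerVector φ w)
    (x : V) : ι z • x = 0 := by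
  obtain ⟨u, rfl⟩ := hw.exists_smul x
  have h1 : ι z • w = 0 := by
    have := hw.1.2 heisenbergZ
    rwa [character_z, map_zero, zero_smul] at this
  rw [← mul_smul, ι_z_mul, mul_smul, h1, smul_zero]

/-- A polynomial in `C₀` carries a quasi-Whittaker vector to zero or to a quasi-Whittaker vector. -/
theorem IsQuasiWhittakerVector.aeval_smul (hz : ∀ x : V, ι z • x = 0) {w : V}
    (hw : IsQuasiWhittakerVector φ w) {g : ℂ[X]} (hg : aeval C₀ g • w ≠ 0) :
    IsQuasiWhittakerVector φ (aeval C₀ g • w) :=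
  ⟨hg, fun x => by rw [← aeval_C₀_smul_comm hz, hw.2, aeval_C₀_smul_comm hz]⟩

theorem IsQuasiWhittakerVector.isCyclic_span {v : V} (hv : IsQuasiWhittakerVector φ v) :
    IsCyclicQuasiWhittakerVector φ
      (⟨v, Submodule.mem_span_singleton_self v⟩ : Submodule.span U {v}) := by
  refine ⟨⟨fun h0 => hv.1 (congrArg Subtype.val h0), fun x => Subtype.ext (hv.2 x)⟩, ?_⟩
  rw [eq_top_iff]
  rintro ⟨x, hx⟩ -
  obtain ⟨u, rfl⟩ := Submodule.mem_span_singleton.1 hx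
  exact Submodule.mem_span_singleton.2 ⟨u, rfl⟩

theorem IsCyclicQuasiWhittakerVector.mkQ {w : V} (hw : IsCyclicQuasiWhittakerVector φ w)
    {M : Submodule U V} (hM : M ≠ ⊤) : IsCyclicQuasiWhittakerVector φ (M.mkQ w) := by
  refine ⟨⟨fun h0 => hM ?_, fun x => ?_⟩, ?_⟩
  · rw [Submodule.mkQ_apply, Submodule.Quotient.mk_eq_zero] at h0
    rw [eq_top_iff, ← hw.2, Submodule.span_singleton_le_iff_mem]
    exact h0
  · rw [← map_smul, hw.1.2, map_smul]
  · rw [← Set.image_singleton, Submodule.span_image, hw.2, Submodule.map_top, Submodule.range_mkQ]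

/-- A quasi-Whittaker module of nonzero type on which `C₀` acts by a scalar is simple. -/
theorem IsCyclicQuasiWhittakerVector.isSimpleModule (hφ : φ ≠ 0) {w : V}
    (hw : IsCyclicQuasiWhittakerVector φ w) {ξ : ℂ} (hξ : (C₀ - algebraMap ℂ U ξ) • w = 0) :
    IsSimpleModule U V := by
  let := complexModule V
  have := complexModule_isScalarTower V
  have hz := hw.z_smul
  rw [isSimpleModule_iff]
  have : Nontrivial V := ⟨w, 0, hw.1.1⟩
  refine { eq_bot_or_eq_top := fun N => or_iff_not_imp_left.2 fun hN => ?_ }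
  obtain ⟨x, hxN, hx0⟩ := N.exists_mem_ne_zero_of_ne_bot hN
  have hst : (moduleRep hz).IsStable (N.restrictScalars ℂ) :=
    ⟨fun y hy => N.smul_mem _ hy, fun y hy => N.smul_mem _ hy, fun y hy => N.smul_mem _ hy,
      fun y hy => N.smul_mem _ hy, fun y hy => N.smul_mem _ hy⟩
  have hwN : w ∈ N.restrictScalars ℂ := by
    refine SchrodingerRep.mem_of_isStable (A := moduleRep hz) (character_ne_zero hφ)
      (hw.1.2 heisenbergP) (hw.1.2 heisenbergQ) (ξ := ξ) ?_ hst hxN hx0 fun M hM hwM => ?_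
    · rw [moduleRep_casimir]
      rwa [sub_smul, sub_eq_zero] at hξ
    · obtain ⟨u, rfl⟩ := hw.exists_smul x
      exact smul_mem_of_isStable hz hM u w hwM
  rw [eq_top_iff, ← hw.2, Submodule.span_singleton_le_iff_mem]
  exact hwN

/-! ### Maximal submodules -/

theorem aeval_X_sub_C (ξ : ℂ) : aeval C₀ (X - C ξ) = C₀ - algebraMap ℂ U ξ := by simp

theorem span_sub_eq_top_or_isCoatom (hφ : φ ≠ 0) {w : V} (hw : IsCyclicQuasiWhittakerVector φ w)
    (ξ : ℂ) : Submodule.span U {(C₀ - algebraMap ℂ U ξ) • w} = ⊤ ∨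
      IsCoatom (Submodule.span U {(C₀ - algebraMap ℂ U ξ) • w}) := by
  refine or_iff_not_imp_left.2 fun hM => ?_
  rw [← isSimpleModule_iff_isCoatom]
  refine (hw.mkQ hM).isSimpleModule hφ (ξ := ξ) ?_
  rw [← map_smul, Submodule.mkQ_apply, Submodule.Quotient.mk_eq_zero]
  exact Submodule.mem_span_singleton_self _

/-- If `(X - ξ) g` annihilates `w` but `g` does not,
then `(C₀ - ξ) w` generates a maximal submodule. -/
theorem isCoatom_span_sub (hφ : φ ≠ 0) {w : V} (hw : IsCyclicQuasiWhittakerVector φ w)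
    {ξ : ℂ} {g : ℂ[X]} (hg : g ∉ annC₀ w) (hgξ : g * (X - C ξ) ∈ annC₀ w) :
    IsCoatom (Submodule.span U {(C₀ - algebraMap ℂ U ξ) • w}) := by
  refine (span_sub_eq_top_or_isCoatom hφ hw ξ).resolve_left fun htop => hg ?_
  obtain ⟨u, hu⟩ := Submodule.mem_span_singleton.1 (htop ▸ Submodule.mem_top : w ∈ _)
  rw [mem_annC₀, map_mul, mul_smul, aeval_X_sub_C] at hgξ
  rw [mem_annC₀, ← hu, aeval_C₀_smul_comm hw.z_smul, hgξ, smul_zero]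

/-- The annihilator in `ℂ[C₀]` of a vector is a prime ideal modulo a maximal submodule, since the
endomorphism ring of a simple module has no zero divisors. -/
theorem isPrime_annC₀_mkQ {w : V} (hw : IsCyclicQuasiWhittakerVector φ w) {M : Submodule U V}
    (hM : IsCoatom M) : (annC₀ (M.mkQ w)).IsPrime := by
  have hmem (g : ℂ[X]) : g ∈ annC₀ (M.mkQ w) ↔ aeval C₀ g • w ∈ M := by
    rw [mem_annC₀, ← map_smul, Submodule.mkQ_apply, Submodule.Quotient.mk_eq_zero]
  refine ⟨fun htop => hM.1 ?_, fun {a b} hab => or_iff_not_imp_right.2 fun hb => ?_⟩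
  · have h1 := (hmem 1).1 (htop ▸ Submodule.mem_top)
    rw [map_one, one_smul] at h1
    rw [eq_top_iff, ← hw.2, Submodule.span_singleton_le_iff_mem]
    exact h1
  · rw [hmem] at hab hb ⊢
    have hlt : M < M ⊔ Submodule.span U {aeval C₀ b • w} :=
      lt_of_le_of_ne le_sup_left fun heq => hb (heq ▸ Submodule.mem_sup_right
        (Submodule.mem_span_singleton_self _))
    obtain ⟨m, hm, y, hy, hmy⟩ := Submodule.mem_sup.1 (hM.2 _ hlt ▸ Submodule.mem_top : w ∈ _)
    obtain ⟨u, rfl⟩ := Submodule.mem_span_singleton.1 hy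
    rw [← hmy, smul_add, aeval_C₀_smul_comm hw.z_smul a u, ← mul_smul (aeval C₀ a), ← map_mul]
    exact add_mem (M.smul_mem _ hm) (M.smul_mem u hab)

/-- If a product of powers of the `X - ξ i` annihilates `w`, then every maximal submodule is
generated by some `(C₀ - ξ i) w`. -/
theorem exists_eq_span_of_isCoatom (hφ : φ ≠ 0) {w : V} (hw : IsCyclicQuasiWhittakerVector φ w)
    {κ : Type*} [Fintype κ] {ξ : κ → ℂ} {a : κ → ℕ} (hd : ∏ i, (X - C (ξ i)) ^ a i ∈ annC₀ w)
    {M : Submodule U V} (hM : IsCoatom M) :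
    ∃ i, M = Submodule.span U {(C₀ - algebraMap ℂ U (ξ i)) • w} := by
  have hprime := isPrime_annC₀_mkQ hw hM
  have hdM : ∏ i, (X - C (ξ i)) ^ a i ∈ annC₀ (M.mkQ w) := by
    rw [mem_annC₀] at hd ⊢
    rw [← map_smul, hd, map_zero]
  obtain ⟨i, -, hi⟩ := (hprime.prod_mem_iff).1 hdM
  have hi' := hprime.mem_of_pow_mem _ hi
  rw [mem_annC₀, aeval_X_sub_C, ← map_smul, Submodule.mkQ_apply,
    Submodule.Quotient.mk_eq_zero] at hi'
  have hle := (Submodule.span_singleton_le_iff_mem _ _).2 hi'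
  refine ⟨i, ?_⟩
  rcases span_sub_eq_top_or_isCoatom hφ hw (ξ i) with h1 | h1
  · exact absurd (top_le_iff.1 (h1 ▸ hle)) hM.1
  · exact (h1.le_iff_eq hM.1).1 hle

/-! ### The primary case -/

/-- If a power of `C₀ - ξ` annihilates the generator, then there is only one maximal submodule. As the
module is finitely generated, every proper submodule lies in it, so two proper submodules cannot
span. -/
theorem isIndecomposable_of_pow_mem (hφ : φ ≠ 0) {w : V} (hw : IsCyclicQuasiWhittakerVector φ w)
    {ξ : ℂ} {n : ℕ} (hn : (X - C ξ) ^ n ∈ annC₀ w) : IsIndecomposable U V := by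
  refine ⟨⟨w, 0, hw.1.1⟩, fun A B hAB => ?_⟩
  have huniq {M : Submodule U V} (hM : IsCoatom M) :
      M = Submodule.span U {(C₀ - algebraMap ℂ U ξ) • w} := by
    obtain ⟨-, h1⟩ := exists_eq_span_of_isCoatom hφ hw (κ := Unit) (ξ := fun _ => ξ)
      (a := fun _ => n) (by simpa using hn) hM
    exact h1
  have : Module.Finite U V := ⟨⟨{w}, by simpa using hw.2⟩⟩
  rcases eq_top_or_exists_le_coatom A with hA | ⟨M, hM, hAM⟩
  · right; simpa [hA] using hAB.disjoint
  rcases eq_top_or_exists_le_coatom B with hB | ⟨M', hM', hBM⟩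
  · left; simpa [hB] using hAB.disjoint
  rw [huniq hM', ← huniq hM] at hBM
  exact absurd (top_le_iff.1 (hAB.codisjoint.eq_top ▸ sup_le hAM hBM)) hM.1

/-- The length of a cyclic module whose generator has annihilator generated by `(X - ξ) ^ (n + 1)`:
the successive quotients by the submodules generated by the `(C₀ - ξ) ^ i w` are simple. -/
theorem length_eq_of_pow_mem (hφ : φ ≠ 0) {ξ : ℂ} (n : ℕ) {V : Type*} [AddCommGroup V] [Module U V]
    {w : V} (hw : IsCyclicQuasiWhittakerVector φ w) (hn : (X - C ξ) ^ n ∉ annC₀ w)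
    (hn' : (X - C ξ) ^ (n + 1) ∈ annC₀ w) : Module.length U V = (n + 1 : ℕ) := by
  induction n generalizing V with
  | zero =>
    rw [zero_add, pow_one, mem_annC₀, aeval_X_sub_C] at hn'
    rw [zero_add, Nat.cast_one, Module.length_eq_one_iff]
    exact hw.isSimpleModule hφ hn'
  | succ n ih =>
    have hann (m : ℕ) : (X - C ξ) ^ (m + 1) ∈ annC₀ w ↔
        aeval C₀ ((X - C ξ) ^ m) • (C₀ - algebraMap ℂ U ξ) • w = 0 := by
      rw [mem_annC₀, pow_succ, map_mul, mul_smul, aeval_X_sub_C]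
    set K := Submodule.span U {(C₀ - algebraMap ℂ U ξ) • w} with hK
    have hcoatom : IsCoatom K := isCoatom_span_sub hφ hw hn (by rwa [← pow_succ])
    have hw1 : IsQuasiWhittakerVector φ ((C₀ - algebraMap ℂ U ξ) • w) := by
      rw [← aeval_X_sub_C]
      refine hw.1.aeval_smul hw.z_smul fun h0 => hn ?_
      rw [hann, ← aeval_X_sub_C, h0, smul_zero]
    have hlenK : Module.length U K = (n + 1 : ℕ) := by
      refine ih hw1.isCyclic_span (fun h0 => hn ?_) ?_
      · rw [hann]
        exact congrArg Subtype.val ((mem_annC₀ _ _).1 h0)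
      · rw [mem_annC₀]
        exact Subtype.ext ((hann _).1 hn')
    have : IsSimpleModule U (V ⧸ K) := isSimpleModule_iff_isCoatom.2 hcoatom
    rw [Module.length_eq_add_of_exact K.subtype K.mkQ K.subtype_injective K.mkQ_surjective
      (LinearMap.exact_subtype_mkQ K), hlenK, Module.length_eq_one]
    push_cast
    rfl

/-! ### Primary decomposition -/

/-- A family of coprime polynomials whose product annihilates the generator decomposes the module
into the submodules generated by the complementary products: by the Chinese remainder theorem there
are polynomials in `C₀` acting as the projections. -/
theorem isInternal_span_prod_erase (hz : ∀ x : V, ι z • x = 0) {w : V}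
    (hw : Submodule.span U {w} = ⊤) {κ : Type*} [Fintype κ] [DecidableEq κ] [Nonempty κ]
    {s : κ → ℂ[X]} (hs : Pairwise (Function.onFun IsCoprime s)) (hd : ∏ i, s i ∈ annC₀ w)
    {W : κ → Submodule U V}
    (hW : ∀ j, W j = Submodule.span U {aeval C₀ (∏ i ∈ Finset.univ.erase j, s i) • w}) :
    DirectSum.IsInternal W := by
  obtain ⟨μ, hμ⟩ := exists_sum_eq_one_iff_pairwise_coprime'.2 hs
  have hcompl (j : κ) : ({j}ᶜ : Finset κ) = Finset.univ.erase j := by ext; simp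
  simp only [hcompl] at hμ
  set d : κ → ℂ[X] := fun j => ∏ i ∈ Finset.univ.erase j, s i with hd_def
  have hμ' : ∑ j, μ j * d j = 1 := hμ
  -- The projections kill the other summands.
  have hzero {i j : κ} (hij : i ≠ j) {x : V} (hx : x ∈ W i) : aeval C₀ (μ j * d j) • x = 0 := by
    rw [hW] at hx
    obtain ⟨u, rfl⟩ := Submodule.mem_span_singleton.1 hx
    have hdvd : ∏ i, s i ∣ μ j * d j * d i := by
      rw [mul_assoc]
      refine Dvd.dvd.mul_left ?_ _
      rw [← Finset.mul_prod_erase Finset.univ s (Finset.mem_univ i)]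
      exact mul_dvd_mul (Finset.dvd_prod_of_mem s (by simp [hij])) dvd_rfl
    rw [aeval_C₀_smul_comm hz, ← mul_smul (aeval C₀ _), ← map_mul,
      (mem_annC₀ _ _).1 (Ideal.mem_of_dvd _ hdvd hd), smul_zero]
  have hsum (x : V) : ∑ j, aeval C₀ (μ j * d j) • x = x := by
    rw [← Finset.sum_smul, ← map_sum, hμ', map_one, one_smul]
  refine DirectSum.isInternal_submodule_of_iSupIndep_of_iSup_eq_top ?_ ?_
  · intro j
    rw [Submodule.disjoint_def]
    intro x hx hx'
    have h1 : aeval C₀ (μ j * d j) • x = 0 := by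
      have hle : ⨆ (i) (_ : i ≠ j), W i ≤ LinearMap.ker
          ({ toFun := fun y => aeval C₀ (μ j * d j) • y
             map_add' := smul_add _
             map_smul' := fun u y => aeval_C₀_smul_comm hz _ u y } : V →ₗ[U] V) :=
        iSup₂_le fun i hij y hy => hzero hij hy
      exact hle hx'
    rw [← hsum x, Finset.sum_eq_single_of_mem j (Finset.mem_univ j)
      fun i _ hij => hzero hij.symm hx, h1]
  · rw [eq_top_iff, ← hw, Submodule.span_singleton_le_iff_mem, ← hsum w]
    refine sum_mem fun j _ => Submodule.mem_iSup_of_mem j ?_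
    rw [hW, map_mul, mul_smul]
    exact Submodule.smul_mem _ _ (Submodule.mem_span_singleton_self _)

end Schrodinger

open Schrodinger in
theorem theorem5p2 {V : Type*} [AddCommGroup V] [Module Schrodinger.U V]
    (φ : LieAlgebra.LieCharacter ℂ Schrodinger.heisenberg) (hφ : φ ≠ 0)
    (w : V) (hw : Schrodinger.IsCyclicQuasiWhittakerVector φ w)
    (hann : Schrodinger.annC₀ w ≠ ⊥)
    (k : ℕ) (ξ : Fin k → ℂ) (hξ : Function.Injective ξ)
    (a : Fin k → ℕ) (ha : ∀ i, 0 < a i)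
    (hd : Schrodinger.annC₀ w = Ideal.span {∏ i, (X - C (ξ i)) ^ a i})
    (w' : Fin k → V)
    (hw' : ∀ j, w' j =
      aeval Schrodinger.C₀ (∏ i ∈ Finset.univ.erase j, (X - C (ξ i)) ^ a i) • w)
    (W : Fin k → Submodule Schrodinger.U V)
    (hW : ∀ j, W j = Submodule.span Schrodinger.U {w' j}) :
    (∀ M : Submodule Schrodinger.U V, IsCoatom M ↔
      ∃ i, M = Submodule.span Schrodinger.U
        {(Schrodinger.C₀ - algebraMap ℂ Schrodinger.U (ξ i)) • w}) ∧
    (∀ j, Schrodinger.IsQuasiWhittakerModule (W j) φ ∧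
      ∃ hj : w' j ∈ W j,
        Schrodinger.IsCyclicQuasiWhittakerVector φ (⟨w' j, hj⟩ : W j)) ∧
    DirectSum.IsInternal W ∧
    (∀ j, Schrodinger.IsIndecomposable Schrodinger.U (W j)) ∧
    (∀ j, IsSimpleModule Schrodinger.U (W j) ↔ a j = 1) ∧
    (∀ j, Module.length Schrodinger.U (W j) = a j) ∧
    Module.length Schrodinger.U V = ∑ i, (a i : ℕ∞) ∧
    (∃ s : CompositionSeries (Submodule Schrodinger.U V),
      s.head = ⊥ ∧ s.last = ⊤ ∧ s.length = ∑ i, a i) := by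
  have hz := hw.z_smul
  have hmonic (i : Fin k) : (X - C (ξ i)) ^ a i ≠ 0 := pow_ne_zero _ (X_sub_C_ne_zero _)
  have hdmem : ∏ i, (X - C (ξ i)) ^ a i ∈ annC₀ w := hd ▸ Ideal.mem_span_singleton_self _
  have : Nonempty (Fin k) := by
    by_contra hk
    rw [not_nonempty_iff] at hk
    rw [mem_annC₀, Finset.univ_eq_empty, Finset.prod_empty, map_one, one_smul] at hdmem
    exact hw.1.1 hdmem
  -- The annihilator of `w' j` is generated by `(X - ξ j) ^ a j`.
  have hannw (j : Fin k) (m : ℕ) :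
      (X - C (ξ j)) ^ m * ∏ i ∈ Finset.univ.erase j, (X - C (ξ i)) ^ a i ∈ annC₀ w ↔ a j ≤ m := by
    rw [hd, Ideal.mem_span_singleton, ← Finset.mul_prod_erase Finset.univ _ (Finset.mem_univ j),
      mul_dvd_mul_iff_right (Finset.prod_ne_zero_iff.2 fun i _ => hmonic i),
      pow_dvd_pow_iff (X_sub_C_ne_zero _) (not_isUnit_X_sub_C _)]
  have hannw' (j : Fin k) (m : ℕ) : (X - C (ξ j)) ^ m ∈ annC₀ (w' j) ↔ a j ≤ m := by
    rw [← hannw, mem_annC₀, mem_annC₀, hw', map_mul, mul_smul]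
  have hqw (j : Fin k) : IsQuasiWhittakerVector φ (w' j) := by
    have h0 : w' j ≠ 0 := fun h0 => (ha j).ne'
      (Nat.le_zero.1 ((hannw' j 0).1 ((mem_annC₀ _ _).2 (by rw [h0, smul_zero]))))
    rw [hw'] at h0 ⊢
    exact hw.1.aeval_smul hz h0
  have hcyc (j : Fin k) : ∃ hj : w' j ∈ W j,
      IsCyclicQuasiWhittakerVector φ (⟨w' j, hj⟩ : W j) := by
    rw [hW]
    exact ⟨_, (hqw j).isCyclic_span⟩
  have hannW (j : Fin k) (hj : w' j ∈ W j) (m : ℕ) :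
      (X - C (ξ j)) ^ m ∈ annC₀ (⟨w' j, hj⟩ : W j) ↔ a j ≤ m := by
    rw [← hannw', mem_annC₀, mem_annC₀, Subtype.ext_iff]
    rfl
  have hint : DirectSum.IsInternal W := by
    refine isInternal_span_prod_erase hz hw.2 (s := fun i => (X - C (ξ i)) ^ a i)
      (fun i j hij => ?_) hdmem fun j => by rw [hW, hw']
    exact (isCoprime_X_sub_C_of_isUnit_sub (sub_ne_zero.2 (hξ.ne hij)).isUnit).pow
  have hlen (j : Fin k) : Module.length U (W j) = a j := by
    obtain ⟨hj, hc⟩ := hcyc j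
    obtain ⟨n, hn⟩ := Nat.exists_eq_succ_of_ne_zero (ha j).ne'
    rw [hn]
    exact length_eq_of_pow_mem hφ n hc (by rw [hannW]; omega) (by rw [hannW]; omega)
  have hlenV : Module.length U V = ∑ i, (a i : ℕ∞) := by
    rw [← (LinearEquiv.ofBijective (DirectSum.coeLinearMap W) hint).length_eq,
      (DirectSum.linearEquivFunOnFintype U (Fin k) fun j => W j).length_eq,
      Module.length_pi_of_fintype]
    exact Finset.sum_congr rfl fun j _ => hlen j
  refine ⟨fun M => ⟨exists_eq_span_of_isCoatom hφ hw hdmem, ?_⟩,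
    fun j => ⟨?_, hcyc j⟩, hint, fun j => ?_, fun j => ?_, hlen, hlenV, ?_⟩
  · rintro ⟨j, rfl⟩
    refine isCoatom_span_sub hφ hw
      (g := (X - C (ξ j)) ^ (a j - 1) * ∏ i ∈ Finset.univ.erase j, (X - C (ξ i)) ^ a i) ?_ ?_
    · rw [hannw]
      have := ha j
      omega
    · rw [mul_right_comm, ← pow_succ, hannw]
      omega
  · obtain ⟨hj, hc⟩ := hcyc j
    exact ⟨_, hc⟩
  · obtain ⟨hj, hc⟩ := hcyc j
    exact isIndecomposable_of_pow_mem hφ hc ((hannW j hj (a j)).2 le_rfl)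
  · rw [← Module.length_eq_one_iff, hlen, Nat.cast_eq_one]
  · obtain ⟨s, hs0, hs1⟩ := isFiniteLength_iff_exists_compositionSeries.1
      (Module.length_ne_top_iff.1 (show Module.length U V ≠ ⊤ by
        rw [hlenV, ← Nat.cast_sum]
        exact ENat.natCast_ne_top _))
    refine ⟨s, hs0, hs1, ?_⟩
    have h1 := Module.length_compositionSeries s hs0 hs1
    rw [hlenV, ← Nat.cast_sum] at h1
    exact_mod_cast h1
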